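/- Let $d \ge 1$. Equip $M_d(\mathbb{R})$ with the Euclidean operator norm $\|\cdot\|$ and equip the set $\mathcal{K}(M_d(\mathbb{R}))$ of nonempty compact subsets of $M_d(\mathbb{R})$ with the Hausdorff metric $d_H$; let $\mathcal{K}(GL_d(\mathbb{R}))$ be the subset of those consisting of invertible matrices. The lower spectral radius of a nonempty set $\mathsf{A} \subseteq M_d(\mathbb{R})$ is $$\check{\varrho}(\mathsf{A}) = \inf_{n \ge 1}\ \inf\left\{\|A_n\cdots A_1\|^{1/n} : A_1,\dots,A_n \in \mathsf{A}\right\}.$$ For $d \ge 2$, a set $\mathsf{A} \in \mathcal{K}(GL_d(\mathbb{R}))$ is called $1$-dominated if there is a set $\mathcal{C} \subset \mathbb{R}^d\setminus\{0\}$ that is relatively closed in $\mathbb{R}^d\setminus\{0\}$ and closed under multiplication by nonzero scalars, such that $A(\mathcal{C})$ is contained in the interior of $\mathcal{C}$ for every $A \in \mathsf{A}$, some $1$-dimensional subspace of $\mathbb{R}^d$ is contained in $\mathcal{C}\cup\{0\}$, and some $(d-1)$-dimensional subspace of $\mathbb{R}^d$ does not intersect $\mathcal{C}$. For $d=1$,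 every $\mathsf{A} \in \mathcal{K}(GL_1(\mathbb{R}))$ is called $1$-dominated. Let $\mathcal{D} \subset \mathcal{K}(GL_d(\mathbb{R}))$ be the set of all $1$-dominated sets. Then: 1. $\mathcal{D}$ is open (in $\mathcal{K}(M_d(\mathbb{R}))$, hence also in $\mathcal{K}(GL_d(\mathbb{R}))$), and $\check{\varrho} \colon \mathcal{D} \to \mathbb{R}$ is locally Lipschitz continuous with respect to $d_H$. 2. For every $\mathsf{K} \in \mathcal{D}$ there is a constant $L > 0$ such that for all nonempty compact sets $\mathsf{A}, \mathsf{B} \subseteq \mathsf{K}$ the numbers $\check{\varrho}(\mathsf{A})$ and $\check{\varrho}(\mathsf{B})$ are positive and $$|\log\check{\varrho}(\mathsf{A}) - \log\check{\varrho}(\mathsf{B})| \le L\, d_H(\mathsf{A},\mathsf{B}).$$ -/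

import Mathlib

open TopologicalSpace
open scoped Matrix.Norms.L2Operator

/-- The space of real `d × d` matrices. With the scope `Matrix.Norms.L2Operator` open, its norm is
the operator norm induced by the Euclidean norm on `ℝ^d`. -/
abbrev RealMat (d : ℕ) : Type := Matrix (Fin d) (Fin d) ℝ

/-- The set of all nonempty compact sets of invertible matrices, as a subset of the metric space
of all nonempty compact sets of `d × d` matrices, whose distance is the Hausdorff distance. -/
def compactGL (d : ℕ) : Set (NonemptyCompacts (RealMat d)) :=
  {A | ∀ M ∈ A, IsUnit M}

/-- The lower spectral radius (joint spectral subradius): the infimum over `n ≥ 1` and over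
`A₁, …, Aₙ ∈ A` of `‖Aₙ ⋯ A₁‖ ^ (1 / n)`. -/
noncomputable def lowerSpectralRadius {d : ℕ} (A : Set (RealMat d)) : ℝ :=
  sInf {r : ℝ | ∃ l : List (RealMat d),
    l ≠ [] ∧ (∀ M ∈ l, M ∈ A) ∧ r = ‖l.prod‖ ^ (1 / (l.length : ℝ))}

/-- `C ⊆ ℝ^d \ {0}` is a `k`-multicone for the set of matrices `A`. -/
structure IsMulticone {d : ℕ} (k : ℕ) (A : Set (RealMat d))
    (C : Set (EuclideanSpace ℝ (Fin d))) : Prop where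
  /-- the origin does not belong to `C` -/
  zero_notMem : (0 : EuclideanSpace ℝ (Fin d)) ∉ C
  /-- `C` is relatively closed in `ℝ^d \ {0}` -/
  relClosed : ∃ F : Set (EuclideanSpace ℝ (Fin d)), IsClosed F ∧ C = F \ {0}
  /-- `C` is closed under multiplication by nonzero scalars -/
  homogeneous : ∀ t : ℝ, t ≠ 0 → ∀ v ∈ C, t • v ∈ C
  /-- every matrix of `A` maps `C` into the interior of `C` -/
  mapsTo_interior : ∀ M ∈ A, ∀ v ∈ C, Matrix.toEuclideanLin M v ∈ interior C
  /-- some `k`-dimensional subspace is contained in `C ∪ {0}` -/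
  exists_inside : ∃ E : Submodule ℝ (EuclideanSpace ℝ (Fin d)),
    Module.finrank ℝ E = k ∧ (E : Set (EuclideanSpace ℝ (Fin d))) ⊆ C ∪ {0}
  /-- some `(d - k)`-dimensional subspace does not meet `C` -/
  exists_outside : ∃ E : Submodule ℝ (EuclideanSpace ℝ (Fin d)),
    Module.finrank ℝ E + k = d ∧ Disjoint (E : Set (EuclideanSpace ℝ (Fin d))) C

/-- `k`-domination of a compact set of invertible `d × d` matrices: for `1 ≤ k < d` the existence
of a `k`-multicone, while every such set is `d`-dominated. -/
def IsDominated {d : ℕ} (k : ℕ) (A : Set (RealMat d)) : Prop :=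
  k = d ∨ (1 ≤ k ∧ k < d ∧ ∃ C : Set (EuclideanSpace ℝ (Fin d)), IsMulticone k A C)

/-- The set of all nonempty compact `1`-dominated sets of invertible `d × d` matrices. -/
def oneDominated (d : ℕ) : Set (NonemptyCompacts (RealMat d)) :=
  {A | A ∈ compactGL d ∧ IsDominated 1 (A : Set (RealMat d))}

/-! The operator norm is almost multiplicative on products from a compact set `K` with a
`1`-multicone `C`: `c‖P‖‖Q‖ ≤ ‖P M Q‖` for products `P`, `Q` and `M ∈ K`
(`exists_norm_prod_mul_norm_prod_le`). Indeed `K` maps `C` uniformly inside itself, and a functional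
`φ` is comparable to the norm on `C`, so every product expands vectors of `M(C)` almost maximally.
Hence moving one factor of a product by `δ` changes its norm by a factor at most `1 + δ / c`. Doing
so for all `n` factors and taking `n`-th roots gives `ϱ(B) ≤ (1 + d_H(A, B) / c) ϱ(A)`, from which
both Lipschitz statements follow. Openness holds because the same cone serves all nearby sets. -/

lemma Matrix.norm_toEuclideanLin_apply_le {d : ℕ} (M : RealMat d)
    (v : EuclideanSpace ℝ (Fin d)) : ‖Matrix.toEuclideanLin M v‖ ≤ ‖M‖ * ‖v‖ :=
  Matrix.l2_opNorm_mulVec M v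

lemma Matrix.l2_opNorm_le_of_forall_le {d : ℕ} (M : RealMat d) {c r : ℝ} (hr : 0 < r) (hc : 0 ≤ c)
    (h : ∀ v, ‖v‖ ≤ r → ‖Matrix.toEuclideanLin M v‖ ≤ c) : ‖M‖ * r ≤ c := by
  rw [← le_div_iff₀ hr, Matrix.l2_opNorm_def]
  refine ContinuousLinearMap.opNorm_le_bound _ (by positivity) fun v => ?_
  change ‖Matrix.toEuclideanLin M v‖ ≤ _
  rcases eq_or_ne v 0 with rfl | hv
  · simp
  have hn : 0 < ‖v‖ := norm_pos_iff.2 hv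
  have := h ((r / ‖v‖) • v) (by
    rw [norm_smul, norm_div, norm_norm, Real.norm_of_nonneg hr.le, div_mul_cancel₀ _ hn.ne'])
  rw [map_smul, norm_smul, norm_div, norm_norm, Real.norm_of_nonneg hr.le, div_mul_eq_mul_div,
    div_le_iff₀ hn] at this
  rw [div_mul_eq_mul_div, le_div_iff₀ hr]
  linarith

/-! ### Uniform estimates from a multicone -/

namespace IsMulticone

variable {d k : ℕ} {K : Set (RealMat d)} {C : Set (EuclideanSpace ℝ (Fin d))}

lemma ne_zero (h : IsMulticone k K C) {v : EuclideanSpace ℝ (Fin d)} (hv : v ∈ C) : v ≠ 0 :=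
  fun h0 => h.zero_notMem (h0 ▸ hv)

lemma isCompact_inter_sphere (h : IsMulticone k K C) :
    IsCompact (C ∩ Metric.sphere (0 : EuclideanSpace ℝ (Fin d)) 1) := by
  obtain ⟨F, hF, rfl⟩ := h.relClosed
  have : (F \ {0}) ∩ Metric.sphere (0 : EuclideanSpace ℝ (Fin d)) 1 =
      F ∩ Metric.sphere (0 : EuclideanSpace ℝ (Fin d)) 1 := by
    ext v
    simp only [Set.mem_inter_iff, Set.mem_sdiff, Set.mem_singleton_iff, mem_sphere_zero_iff_norm]
    refine ⟨fun hv => ⟨hv.1.1, hv.2⟩, fun hv => ⟨⟨hv.1, ?_⟩, hv.2⟩⟩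
    rintro rfl
    simp at hv
  rw [this]
  exact (isCompact_sphere _ _).inter_left hF

lemma normalize_mem (h : IsMulticone k K C) {v : EuclideanSpace ℝ (Fin d)} (hv : v ∈ C) :
    ‖v‖⁻¹ • v ∈ C ∩ Metric.sphere (0 : EuclideanSpace ℝ (Fin d)) 1 := by
  have hn : ‖v‖ ≠ 0 := norm_ne_zero_iff.2 (h.ne_zero hv)
  refine ⟨h.homogeneous _ (inv_ne_zero hn) v hv, ?_⟩
  rw [mem_sphere_zero_iff_norm, norm_smul, norm_inv, norm_norm, inv_mul_cancel₀ hn]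

/-- The image of a multicone under a compact set of matrices is uniformly inside the multicone. -/
lemma exists_ball (h : IsMulticone k K C) (hK : IsCompact K) :
    ∃ ε > 0, ∀ M ∈ K, ∀ v ∈ C, ∀ w : EuclideanSpace ℝ (Fin d), ‖w‖ ≤ ε * ‖v‖ →
      Matrix.toEuclideanLin M v + w ∈ C := by
  have hcont : Continuous fun p : RealMat d × EuclideanSpace ℝ (Fin d) =>
      Matrix.toEuclideanLin p.1 p.2 := by
    have h1 : Continuous fun p : RealMat d × EuclideanSpace ℝ (Fin d) =>
        (Matrix.toEuclideanCLM (n := Fin d) (𝕜 := ℝ) p.1) p.2 := by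
      have h2 : Continuous (Matrix.toEuclideanCLM (n := Fin d) (𝕜 := ℝ)) :=
        LinearMap.continuous_of_finiteDimensional
          (Matrix.toEuclideanCLM (n := Fin d) (𝕜 := ℝ)).toAlgEquiv.toLinearMap
      exact (h2.comp continuous_fst).clm_apply continuous_snd
    exact h1
  have hcomp := (hK.prod h.isCompact_inter_sphere).image hcont
  have hsub : (fun p : RealMat d × EuclideanSpace ℝ (Fin d) => Matrix.toEuclideanLin p.1 p.2) ''
      (K ×ˢ (C ∩ Metric.sphere (0 : EuclideanSpace ℝ (Fin d)) 1)) ⊆ interior C := by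
    rintro _ ⟨⟨M, v⟩, ⟨hM, hv⟩, rfl⟩
    exact h.mapsTo_interior M hM v hv.1
  obtain ⟨ε, hε, hεC⟩ := hcomp.exists_cthickening_subset_open isOpen_interior hsub
  refine ⟨ε, hε, fun M hM v hv w hw => ?_⟩
  have hn : 0 < ‖v‖ := norm_pos_iff.2 (h.ne_zero hv)
  have hmem : Matrix.toEuclideanLin M (‖v‖⁻¹ • v) + ‖v‖⁻¹ • w ∈ C := by
    refine interior_subset (hεC ?_)
    refine Metric.mem_cthickening_of_dist_le _ _ _ _
      (Set.mem_image_of_mem _ (Set.mk_mem_prod hM (h.normalize_mem hv))) ?_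
    rw [dist_eq_norm]
    simp only [add_sub_cancel_left]
    rw [norm_smul, norm_inv, norm_norm, inv_mul_le_iff₀ hn]
    linarith
  have := h.homogeneous ‖v‖ hn.ne' _ hmem
  rwa [map_smul, ← smul_add, smul_smul, mul_inv_cancel₀ hn.ne', one_smul] at this

/-- A linear functional bounded away from zero on a `1`-multicone. -/
lemma exists_functional (h : IsMulticone 1 K C) :
    ∃ (φ : EuclideanSpace ℝ (Fin d) →L[ℝ] ℝ), ∃ a > 0, ∀ v ∈ C, a * ‖v‖ ≤ |φ v| := by
  obtain ⟨E, hE, hEC⟩ := h.exists_outside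
  have hlt : E < ⊤ := by
    refine lt_top_iff_ne_top.2 fun ht => ?_
    rw [ht, finrank_top, finrank_euclideanSpace_fin] at hE
    omega
  obtain ⟨f, hf0, hf⟩ := E.exists_le_ker_of_lt_top hlt
  -- `E` is a hyperplane, so the inclusion in the kernel is an equality, and `f` vanishes nowhere on
  -- `C`.
  have hker : E = LinearMap.ker f := by
    refine Submodule.eq_of_le_of_finrank_le hf ?_
    have := Module.Dual.finrank_ker_add_one_of_ne_zero hf0
    rw [finrank_euclideanSpace_fin] at this
    omega
  have hne : ∀ v ∈ C, f v ≠ 0 := fun v hv h0 =>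
    Set.disjoint_left.1 hEC (by rw [hker]; exact h0) hv
  refine ⟨LinearMap.toContinuousLinearMap f, ?_⟩
  have hfc : Continuous f := f.continuous_of_finiteDimensional
  obtain ⟨a, ha, haC⟩ := h.isCompact_inter_sphere.exists_forall_le'
    (f := fun v => |f v|) (a := 0) (hfc.abs.continuousOn)
    (fun v hv => abs_pos.2 (hne v hv.1))
  refine ⟨a, ha, fun v hv => ?_⟩
  have hn : 0 < ‖v‖ := norm_pos_iff.2 (h.ne_zero hv)
  have := haC _ (h.normalize_mem hv)
  simp only [map_smul, smul_eq_mul, abs_mul, abs_inv, abs_norm] at this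
  rw [inv_mul_eq_div, le_div_iff₀ hn] at this
  exact this

lemma prod_mem (h : IsMulticone k K C) (l : List (RealMat d)) (hl : ∀ M ∈ l, M ∈ K)
    {v : EuclideanSpace ℝ (Fin d)} (hv : v ∈ C) : Matrix.toEuclideanLin l.prod v ∈ C := by
  induction l with
  | nil => simpa [Matrix.toLpLin_one] using hv
  | cons M l ih =>
    rw [List.prod_cons, Matrix.toLpLin_mul_same, LinearMap.comp_apply]
    exact interior_subset (h.mapsTo_interior M (hl M (by simp)) _
      (ih fun N hN => hl N (by simp [hN])))


lemma exists_mem (h : IsMulticone 1 K C) : ∃ v, v ∈ C := by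
  obtain ⟨E, hE, hEC⟩ := h.exists_inside
  have : Nontrivial E := Module.nontrivial_of_finrank_pos (R := ℝ) (by omega)
  obtain ⟨v, hv⟩ := exists_ne (0 : E)
  refine ⟨v, (hEC v.2).resolve_right fun h0 => hv ?_⟩
  exact Subtype.ext h0

/-- Products of matrices expand the vectors in the image of the multicone almost as much as their
norm allows. -/
lemma exists_le_norm_prod_mul_apply (h : IsMulticone 1 K C) (hK : IsCompact K) :
    ∃ κ > 0, ∀ l : List (RealMat d), (∀ M ∈ l, M ∈ K) → ∀ M ∈ K, ∀ v ∈ C,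
      κ * ‖l.prod‖ * ‖v‖ ≤ ‖Matrix.toEuclideanLin l.prod (Matrix.toEuclideanLin M v)‖ := by
  obtain ⟨ε, hε, hball⟩ := h.exists_ball hK
  obtain ⟨φ, a, ha, hφ⟩ := h.exists_functional
  refine ⟨ε / (2 * ‖φ‖ / a + 1), by positivity, fun l hl M hM v hv => ?_⟩
  have hn : 0 < ‖v‖ := norm_pos_iff.2 (h.ne_zero hv)
  set T := Matrix.toEuclideanLin l.prod
  set u := Matrix.toEuclideanLin M v
  have hmem : ∀ w, ‖w‖ ≤ ε * ‖v‖ → T u + T w ∈ C := fun w hw => by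
    rw [← map_add]
    exact h.prod_mem l hl (hball M hM v hv w hw)
  -- The ball around `u` is mapped by `T` into `C`, where `φ` has no zero.
  have hne : ∀ w, ‖w‖ ≤ ε * ‖v‖ → φ (T u) + φ (T w) ≠ 0 := fun w hw h0 => by
    have h1 := hφ _ (hmem w hw)
    rw [map_add, h0, abs_zero] at h1
    have h2 : 0 < ‖T u + T w‖ := norm_pos_iff.2 (h.ne_zero (hmem w hw))
    have := mul_pos ha h2
    linarith
  have hle : ∀ w, ‖w‖ ≤ ε * ‖v‖ → |φ (T w)| ≤ |φ (T u)| := fun w hw => by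
    by_contra! hlt
    have hpos : 0 < |φ (T w)| := (abs_nonneg _).trans_lt hlt
    have hne0 : φ (T w) ≠ 0 := abs_pos.1 hpos
    -- This multiple of `w` is no longer than `w`, yet `φ ∘ T` would vanish at its sum with `u`.
    refine hne ((-(φ (T u) / φ (T w))) • w) ?_ ?_
    · rw [norm_smul, norm_neg, norm_div, Real.norm_eq_abs, Real.norm_eq_abs]
      have : |φ (T u)| / |φ (T w)| ≤ 1 := (div_le_one hpos).2 hlt.le
      calc _ ≤ 1 * ‖w‖ := by gcongr
        _ ≤ _ := by rwa [one_mul]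
    · rw [map_smul, map_smul, smul_eq_mul, neg_mul, div_mul_cancel₀ _ hne0, add_neg_cancel]
  have hbound : ‖l.prod‖ * (ε * ‖v‖) ≤ (2 * ‖φ‖ / a + 1) * ‖T u‖ := by
    refine Matrix.l2_opNorm_le_of_forall_le _ (by positivity) (by positivity) fun w hw => ?_
    have h1 := hφ _ (hmem w hw)
    rw [map_add] at h1
    have h2 := abs_add_le (φ (T u)) (φ (T w))
    have h3 : |φ (T u)| ≤ ‖φ‖ * ‖T u‖ := φ.le_opNorm _
    have h4 : ‖T u + T w‖ ≤ 2 * ‖φ‖ / a * ‖T u‖ := by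
      rw [div_mul_eq_mul_div, le_div_iff₀ ha]
      linarith [hle w hw]
    have h5 : ‖T w‖ ≤ ‖T u + T w‖ + ‖T u‖ := by
      simpa using norm_sub_le (T u + T w) (T u)
    change ‖T w‖ ≤ _
    linarith
  rw [div_mul_eq_mul_div, div_mul_eq_mul_div, div_le_iff₀ (by positivity)]
  linarith

/-- The ball of radius `ε‖v‖` around `M v` lies in `C`, hence misses the origin. -/
lemma exists_le_norm_apply (h : IsMulticone k K C) (hK : IsCompact K) :
    ∃ ε > 0, ∀ M ∈ K, ∀ v ∈ C, ε * ‖v‖ ≤ ‖Matrix.toEuclideanLin M v‖ := by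
  obtain ⟨ε, hε, hball⟩ := h.exists_ball hK
  refine ⟨ε, hε, fun M hM v hv => ?_⟩
  by_contra! hlt
  have := hball M hM v hv (-Matrix.toEuclideanLin M v) (by rw [norm_neg]; exact hlt.le)
  rw [add_neg_cancel] at this
  exact h.zero_notMem this

/-- The norm is almost multiplicative on products of matrices. -/
lemma exists_norm_prod_mul_norm_prod_le (h : IsMulticone 1 K C) (hK : IsCompact K) :
    ∃ c > 0, ∀ l l' : List (RealMat d), (∀ M ∈ l, M ∈ K) → (∀ M ∈ l', M ∈ K) → ∀ M ∈ K,
      c * ‖l.prod‖ * ‖l'.prod‖ ≤ ‖l.prod * M * l'.prod‖ := by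
  obtain ⟨κ, hκ, hprod⟩ := h.exists_le_norm_prod_mul_apply hK
  obtain ⟨v, hv⟩ := h.exists_mem
  have hn : 0 < ‖v‖ := norm_pos_iff.2 (h.ne_zero hv)
  obtain ⟨R, hR⟩ := hK.isBounded.exists_norm_le
  have hR1 : 0 < max R 1 := lt_max_of_lt_right one_pos
  -- The expansion estimate needs a vector of the form `M v`, so the rightmost factor is split off,
  -- at a cost of at most `max R 1`; the `1` in the minimum covers the empty product.
  have key : ∀ l' : List (RealMat d), (∀ M ∈ l', M ∈ K) →
      min 1 (κ / max R 1) * ‖l'.prod‖ * ‖v‖ ≤ ‖Matrix.toEuclideanLin l'.prod v‖ := by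
    intro l' hl'
    rcases List.eq_nil_or_concat l' with rfl | ⟨l', M, rfl⟩
    · simp only [List.prod_nil, Matrix.toLpLin_one, LinearMap.id_apply]
      have h1 : ‖(1 : RealMat d)‖ * 1 ≤ 1 :=
        Matrix.l2_opNorm_le_of_forall_le _ one_pos one_pos.le fun w hw => by
          simpa [Matrix.toLpLin_one] using hw
      calc _ ≤ 1 * 1 * ‖v‖ := by
            gcongr
            · exact min_le_left _ _
            · linarith
        _ = _ := by ring
    · rw [List.concat_eq_append] at hl' ⊢
      simp only [List.mem_append, List.mem_singleton] at hl'
      rw [List.prod_append, List.prod_singleton, Matrix.toLpLin_mul_same, LinearMap.comp_apply]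
      have hM : M ∈ K := hl' M (Or.inr rfl)
      refine le_trans ?_ (hprod l' (fun N hN => hl' N (Or.inl hN)) M hM v hv)
      calc _ ≤ κ / max R 1 * (‖l'.prod‖ * max R 1) * ‖v‖ := by
            gcongr
            · exact min_le_right _ _
            · exact (norm_mul_le _ _).trans
                (by gcongr; exact (hR M hM).trans (le_max_left _ _))
        _ = _ := by field_simp
  refine ⟨κ * min 1 (κ / max R 1), by positivity, fun l l' hl hl' M hM => ?_⟩
  refine le_of_mul_le_mul_right ?_ hn
  refine le_trans ?_ (Matrix.norm_toEuclideanLin_apply_le _ v)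
  rw [Matrix.toLpLin_mul_same, LinearMap.comp_apply, Matrix.toLpLin_mul_same, LinearMap.comp_apply]
  refine le_trans ?_ (hprod l hl M hM _ (h.prod_mem l' hl' hv))
  calc _ = κ * ‖l.prod‖ * (min 1 (κ / max R 1) * ‖l'.prod‖ * ‖v‖) := by ring
    _ ≤ _ := by gcongr; exact key l' hl'

lemma exists_pow_length_le_norm_prod (h : IsMulticone 1 K C) (hK : IsCompact K) :
    ∃ ε > 0, ∀ l : List (RealMat d), (∀ M ∈ l, M ∈ K) → ε ^ l.length ≤ ‖l.prod‖ := by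
  obtain ⟨ε, hε, hle⟩ := h.exists_le_norm_apply hK
  obtain ⟨v, hv⟩ := h.exists_mem
  have hn : 0 < ‖v‖ := norm_pos_iff.2 (h.ne_zero hv)
  refine ⟨ε, hε, fun l hl => ?_⟩
  refine le_of_mul_le_mul_right (le_trans ?_ (Matrix.norm_toEuclideanLin_apply_le _ v)) hn
  induction l with
  | nil => simp [Matrix.toLpLin_one]
  | cons M l ih =>
    have hl' : ∀ N ∈ l, N ∈ K := fun N hN => hl N (by simp [hN])
    rw [List.prod_cons, Matrix.toLpLin_mul_same, LinearMap.comp_apply, List.length_cons, pow_succ']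
    refine le_trans ?_ (hle M (hl M (by simp)) _ (h.prod_mem l hl' hv))
    rw [mul_assoc]
    gcongr
    exact ih hl'

/-- A multicone for a compact set is a multicone for a neighbourhood of it. -/
lemma exists_cthickening (h : IsMulticone k K C) (hK : IsCompact K) :
    ∃ δ > 0, IsMulticone k (Metric.cthickening δ K) C := by
  obtain ⟨ε, hε, hball⟩ := h.exists_ball hK
  -- Half of `ε` absorbs the change of matrix; the other half leaves a ball around the image.
  refine ⟨ε / 2, half_pos hε, { h with mapsTo_interior := fun M hM v hv => ?_ }⟩
  rw [hK.cthickening_eq_biUnion_closedBall (half_pos hε).le] at hM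
  simp only [Set.mem_iUnion, Metric.mem_closedBall, exists_prop] at hM
  obtain ⟨N, hN, hMN⟩ := hM
  have hn : 0 < ‖v‖ := norm_pos_iff.2 (h.ne_zero hv)
  rw [mem_interior_iff_mem_nhds]
  refine Filter.mem_of_superset
    (Metric.closedBall_mem_nhds _ (show 0 < ε / 2 * ‖v‖ by positivity)) fun w hw => ?_
  have hw' : Matrix.toEuclideanLin N v + (w - Matrix.toEuclideanLin N v) ∈ C := by
    refine hball N hN v hv _ ?_
    have h1 : ‖w - Matrix.toEuclideanLin M v‖ ≤ ε / 2 * ‖v‖ := by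
      rwa [← dist_eq_norm]
    have h2 : ‖Matrix.toEuclideanLin M v - Matrix.toEuclideanLin N v‖ ≤ ε / 2 * ‖v‖ := by
      rw [← LinearMap.sub_apply, ← map_sub]
      refine (Matrix.norm_toEuclideanLin_apply_le _ v).trans ?_
      rw [← dist_eq_norm]
      gcongr
    have h3 := norm_add_le (w - Matrix.toEuclideanLin M v)
      (Matrix.toEuclideanLin M v - Matrix.toEuclideanLin N v)
    rw [sub_add_sub_cancel] at h3
    linarith
  rwa [add_sub_cancel] at hw'

end IsMulticone

/-! ### Domination in terms of multicones -/

/-- In dimension one all nonzero vectors form a multicone for any set of invertible matrices. -/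
lemma isMulticone_one_compl_zero {A : Set (RealMat 1)} (hA : ∀ M ∈ A, IsUnit M) :
    IsMulticone 1 A {0}ᶜ where
  zero_notMem := by simp
  relClosed := ⟨Set.univ, isClosed_univ, by rw [Set.compl_eq_univ_sdiff]⟩
  homogeneous t ht v hv := smul_ne_zero ht hv
  mapsTo_interior M hM v hv := by
    rw [isOpen_compl_singleton.interior_eq]
    intro h0
    obtain ⟨N, hN⟩ := (hA M hM).exists_left_inv
    refine hv ?_
    have h1 : Matrix.toEuclideanLin (N * M) v = 0 := by
      rw [Matrix.toLpLin_mul_same, LinearMap.comp_apply, Set.mem_singleton_iff.1 h0, map_zero]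
    rwa [hN, Matrix.toLpLin_one] at h1
  exists_inside := ⟨⊤, by simp, fun v _ => (em (v = 0)).symm⟩
  exists_outside := ⟨⊥, by simp, by simp⟩

/-- Removes the special convention for `d = 1`, so that all dimensions are treated alike. -/
lemma mem_oneDominated_iff {d : ℕ} (hd : 1 ≤ d) {A : NonemptyCompacts (RealMat d)} :
    A ∈ oneDominated d ↔ A ∈ compactGL d ∧ ∃ C, IsMulticone 1 (A : Set (RealMat d)) C := by
  refine and_congr_right fun hA => ⟨?_, fun hC => ?_⟩
  · rintro (rfl | ⟨-, -, hC⟩)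
    · exact ⟨_, isMulticone_one_compl_zero hA⟩
    · exact hC
  · rcases hd.eq_or_lt with h1 | h1
    · exact Or.inl h1
    · exact Or.inr ⟨le_rfl, h1, hC⟩

lemma IsMulticone.mono {d k : ℕ} {A K : Set (RealMat d)} {C : Set (EuclideanSpace ℝ (Fin d))}
    (h : IsMulticone k K C) (hA : A ⊆ K) : IsMulticone k A C :=
  { h with mapsTo_interior := fun M hM => h.mapsTo_interior M (hA hM) }

/-! ### Perturbation of products and of the lower spectral radius -/

/-- If the norm is almost multiplicative, replacing the factors of a product by factors at distance
at most `δ` changes the norm at most by a factor exponential in `δ` times the length. -/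
lemma norm_prod_mul_prod_le {d : ℕ} {K : Set (RealMat d)} {c δ : ℝ} (hc : 0 < c) (hδ : 0 ≤ δ)
    (hK : ∀ l l' : List (RealMat d), (∀ M ∈ l, M ∈ K) → (∀ M ∈ l', M ∈ K) → ∀ M ∈ K,
      c * ‖l.prod‖ * ‖l'.prod‖ ≤ ‖l.prod * M * l'.prod‖)
    {a b : List (RealMat d)} (hab : List.Forall₂ (fun M N => dist M N ≤ δ) a b)
    (ha : ∀ M ∈ a, M ∈ K) (hb : ∀ M ∈ b, M ∈ K) (p : List (RealMat d)) (hp : ∀ M ∈ p, M ∈ K) :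
    ‖p.prod * b.prod‖ ≤ (1 + δ / c) ^ a.length * ‖p.prod * a.prod‖ := by
  induction hab generalizing p with
  | nil => simp
  | @cons M N a b hMN hab ih =>
    simp only [List.mem_cons, forall_eq_or_imp] at ha hb
    -- The prefix `p` collects the factors already replaced.
    have h1 := ih ha.2 hb.2 (p ++ [N]) (by
      simp only [List.mem_append, List.mem_singleton]
      rintro x (hx | rfl)
      exacts [hp x hx, hb.1])
    rw [List.prod_append, List.prod_singleton] at h1
    have h2 : ‖p.prod * N * a.prod‖ ≤ (1 + δ / c) * ‖p.prod * M * a.prod‖ := by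
      have h3 : p.prod * N * a.prod = p.prod * M * a.prod - p.prod * (M - N) * a.prod := by
        noncomm_ring
      have h4 : ‖p.prod * (M - N) * a.prod‖ ≤ ‖p.prod‖ * δ * ‖a.prod‖ := by
        rw [dist_eq_norm] at hMN
        refine (norm_mul_le _ _).trans ?_
        gcongr
        refine (norm_mul_le _ _).trans ?_
        gcongr
      have h5 : ‖p.prod‖ * δ * ‖a.prod‖ ≤ δ / c * ‖p.prod * M * a.prod‖ := by
        calc _ = δ / c * (c * ‖p.prod‖ * ‖a.prod‖) := by field_simp
          _ ≤ _ := by gcongr; exact hK p a hp ha.2 M ha.1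
      rw [h3]
      refine (norm_sub_le _ _).trans ?_
      linarith
    rw [List.prod_cons, List.prod_cons, ← mul_assoc, ← mul_assoc, List.length_cons, pow_succ,
      mul_assoc (_ ^ _)]
    exact h1.trans (by gcongr)

lemma bddBelow_lowerSpectralRadius_set {d : ℕ} (A : Set (RealMat d)) :
    BddBelow {r : ℝ | ∃ l : List (RealMat d),
      l ≠ [] ∧ (∀ M ∈ l, M ∈ A) ∧ r = ‖l.prod‖ ^ (1 / (l.length : ℝ))} := by
  refine ⟨0, ?_⟩
  rintro _ ⟨l, -, -, rfl⟩
  positivity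

lemma lowerSpectralRadius_le {d : ℕ} {A : Set (RealMat d)} {l : List (RealMat d)} (hl : l ≠ [])
    (hA : ∀ M ∈ l, M ∈ A) : lowerSpectralRadius A ≤ ‖l.prod‖ ^ (1 / (l.length : ℝ)) :=
  csInf_le (bddBelow_lowerSpectralRadius_set A) ⟨l, hl, hA, rfl⟩

lemma lowerSpectralRadius_le_norm {d : ℕ} {A : Set (RealMat d)} {M : RealMat d} (hM : M ∈ A) :
    lowerSpectralRadius A ≤ ‖M‖ := by
  simpa using lowerSpectralRadius_le (l := [M]) (by simp) (by simpa using hM)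

lemma le_lowerSpectralRadius {d : ℕ} {A : Set (RealMat d)} (hA : A.Nonempty) {x : ℝ}
    (h : ∀ l : List (RealMat d), l ≠ [] → (∀ M ∈ l, M ∈ A) →
      x ≤ ‖l.prod‖ ^ (1 / (l.length : ℝ))) : x ≤ lowerSpectralRadius A := by
  obtain ⟨M, hM⟩ := hA
  refine le_csInf ⟨_, [M], by simp, by simpa using hM, rfl⟩ ?_
  rintro _ ⟨l, hl, hlA, rfl⟩
  exact h l hl hlA

lemma lowerSpectralRadius_le_mul {d : ℕ} {K A B : Set (RealMat d)} {c δ : ℝ} (hc : 0 < c)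
    (hδ : 0 ≤ δ)
    (hK : ∀ l l' : List (RealMat d), (∀ M ∈ l, M ∈ K) → (∀ M ∈ l', M ∈ K) → ∀ M ∈ K,
      c * ‖l.prod‖ * ‖l'.prod‖ ≤ ‖l.prod * M * l'.prod‖)
    (hA : A.Nonempty) (hAK : A ⊆ K) (hBK : B ⊆ K) (hAB : ∀ M ∈ A, ∃ N ∈ B, dist M N ≤ δ) :
    lowerSpectralRadius B ≤ (1 + δ / c) * lowerSpectralRadius A := by
  have h0 : 0 < 1 + δ / c := by positivity
  rw [← div_le_iff₀' h0]
  refine le_lowerSpectralRadius hA fun l hl hlA => ?_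
  rw [div_le_iff₀' h0]
  -- A product from `A` is shadowed, factor by factor, by one from `B` of the same length.
  choose! g hgB hg using hAB
  have hmap : ∀ M ∈ l.map g, M ∈ B := by
    simp only [List.mem_map]
    rintro _ ⟨M, hM, rfl⟩
    exact hgB M (hlA M hM)
  refine (lowerSpectralRadius_le (l := l.map g) (by simpa using hl) hmap).trans ?_
  have hforall : List.Forall₂ (fun M N => dist M N ≤ δ) l (l.map g) := by
    rw [List.forall₂_map_right_iff, List.forall₂_same]
    exact fun M hM => hg M (hlA M hM)
  have hle := norm_prod_mul_prod_le hc hδ hK hforall (fun M hM => hAK (hlA M hM))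
    (fun M hM => hBK (hmap M hM)) [] (by simp)
  simp only [List.prod_nil, one_mul] at hle
  have hlen : l.length ≠ 0 := by simpa using hl
  rw [List.length_map]
  calc _ ≤ ((1 + δ / c) ^ l.length * ‖l.prod‖) ^ (1 / (l.length : ℝ)) := by gcongr
    _ = _ := by
      rw [Real.mul_rpow (by positivity) (norm_nonneg _), one_div,
        Real.pow_rpow_inv_natCast h0.le hlen]

/-- On the compact subsets of a compact set with a multicone the lower spectral radius is bounded
away from zero, and it is Lipschitz in the logarithmic scale. -/
lemma IsMulticone.exists_lowerSpectralRadius_bounds {d : ℕ} {K : Set (RealMat d)}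
    {C : Set (EuclideanSpace ℝ (Fin d))} (h : IsMulticone 1 K C) (hK : IsCompact K) :
    ∃ L > 0, ∀ A B : NonemptyCompacts (RealMat d), (A : Set (RealMat d)) ⊆ K →
      (B : Set (RealMat d)) ⊆ K → 0 < lowerSpectralRadius (A : Set (RealMat d)) ∧
        lowerSpectralRadius (B : Set (RealMat d)) ≤
          (1 + L * dist A B) * lowerSpectralRadius (A : Set (RealMat d)) := by
  obtain ⟨c, hc, hle⟩ := h.exists_norm_prod_mul_norm_prod_le hK
  obtain ⟨ε, hε, hpow⟩ := h.exists_pow_length_le_norm_prod hK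
  refine ⟨c⁻¹, inv_pos.2 hc, fun A B hA hB => ⟨hε.trans_le ?_, ?_⟩⟩
  · refine le_lowerSpectralRadius A.nonempty fun l hl hlA => ?_
    have hlen : l.length ≠ 0 := by simpa using hl
    calc ε = (ε ^ l.length) ^ (1 / (l.length : ℝ)) := by
          rw [one_div, Real.pow_rpow_inv_natCast hε.le hlen]
      _ ≤ _ := by
        gcongr
        exact hpow l fun M hM => hA (hlA M hM)
  · rw [inv_mul_eq_div]
    refine lowerSpectralRadius_le_mul hc dist_nonneg hle A.nonempty hA hB fun M hM => ?_
    obtain ⟨N, hN, hMN⟩ := B.isCompact.exists_infDist_eq_dist B.nonempty M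
    refine ⟨N, hN, ?_⟩
    rw [← hMN, Metric.NonemptyCompacts.dist_eq]
    exact Metric.infDist_le_hausdorffDist_of_mem hM
      (Metric.hausdorffEDist_ne_top_of_nonempty_of_bounded A.nonempty B.nonempty
        A.isCompact.isBounded B.isCompact.isBounded)

/-! ### Openness and Lipschitz continuity -/

/-- A `1`-dominated set has a compact neighbourhood consisting of invertible matrices and having a
multicone, which contains all nonempty compact sets close to the given one. -/
lemma exists_isMulticone_nhds {d : ℕ} (hd : 1 ≤ d) {A : NonemptyCompacts (RealMat d)}
    (hA : A ∈ oneDominated d) : ∃ K : Set (RealMat d), IsCompact K ∧ (∀ M ∈ K, IsUnit M) ∧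
      (∃ C, IsMulticone 1 K C) ∧ ∀ᶠ B : NonemptyCompacts (RealMat d) in nhds A,
        (B : Set (RealMat d)) ⊆ K := by
  obtain ⟨hAGL, C, hC⟩ := (mem_oneDominated_iff hd).1 hA
  obtain ⟨δ, hδ, hδC⟩ := hC.exists_cthickening A.isCompact
  have hunit : IsOpen {M : RealMat d | IsUnit M} := Units.isOpen
  obtain ⟨η, hη, hηU⟩ := A.isCompact.exists_cthickening_subset_open hunit hAGL
  refine ⟨Metric.cthickening (min δ η) A, A.isCompact.cthickening,
    fun M hM => hηU (Metric.cthickening_mono (min_le_right _ _) _ hM),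
    ⟨C, hδC.mono (Metric.cthickening_mono (min_le_left _ _) _)⟩, ?_⟩
  filter_upwards [Metric.ball_mem_nhds A (lt_min hδ hη)] with B hB M hM
  obtain ⟨N, hN, hMN⟩ := A.isCompact.exists_infDist_eq_dist A.nonempty M
  refine Metric.mem_cthickening_of_dist_le _ _ _ _ hN ?_
  rw [← hMN]
  refine le_trans ?_ (Metric.mem_ball.1 hB).le
  rw [Metric.NonemptyCompacts.dist_eq]
  exact Metric.infDist_le_hausdorffDist_of_mem hM
    (Metric.hausdorffEDist_ne_top_of_nonempty_of_bounded B.nonempty A.nonempty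
      B.isCompact.isBounded A.isCompact.isBounded)

theorem isOpen_oneDominated {d : ℕ} (hd : 1 ≤ d) : IsOpen (oneDominated d) := by
  rw [isOpen_iff_mem_nhds]
  intro A hA
  obtain ⟨K, -, hU, ⟨C, hC⟩, hev⟩ := exists_isMulticone_nhds hd hA
  filter_upwards [hev] with B hB
  exact (mem_oneDominated_iff hd).2 ⟨fun M hM => hU M (hB hM), C, hC.mono hB⟩

theorem locallyLipschitzOn_lowerSpectralRadius {d : ℕ} (hd : 1 ≤ d) :
    LocallyLipschitzOn (oneDominated d)
      (fun A : NonemptyCompacts (RealMat d) => lowerSpectralRadius (A : Set (RealMat d))) := by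
  intro A hA
  obtain ⟨K, hK, -, ⟨C, hC⟩, hev⟩ := exists_isMulticone_nhds hd hA
  obtain ⟨L, hL, hbound⟩ := hC.exists_lowerSpectralRadius_bounds hK
  obtain ⟨R, hR⟩ := hK.isBounded.exists_norm_le
  -- The multiplicative bound becomes additive because `lowerSpectralRadius` is at most `R` on
  -- subsets of `K`.
  refine ⟨(L * R).toNNReal, {B | (B : Set (RealMat d)) ⊆ K}, mem_nhdsWithin_of_mem_nhds hev,
    LipschitzOnWith.of_le_add_mul _ fun B hB B' hB' => ?_⟩
  have h1 := (hbound B' B hB' hB).2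
  obtain ⟨M, hM⟩ := B'.nonempty
  have h2 : lowerSpectralRadius (B' : Set (RealMat d)) ≤ R :=
    (lowerSpectralRadius_le_norm hM).trans (hR M (hB' hM))
  have h3 : L * dist B' B * lowerSpectralRadius (B' : Set (RealMat d)) ≤ L * dist B' B * R := by
    gcongr
  have h4 : L * R * dist B B' ≤ (L * R).toNNReal * dist B B' := by
    gcongr
    exact Real.le_coe_toNNReal _
  rw [dist_comm B' B] at h1 h3
  linarith

theorem mainTheorem3 (d : ℕ) (hd : 1 ≤ d) :
    IsOpen (oneDominated d) ∧
    LocallyLipschitzOn (oneDominated d)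
      (fun A : NonemptyCompacts (RealMat d) => lowerSpectralRadius (A : Set (RealMat d))) ∧
    ∀ K ∈ oneDominated d, ∃ L : ℝ, 0 < L ∧
      ∀ A B : NonemptyCompacts (RealMat d),
        (A : Set (RealMat d)) ⊆ K → (B : Set (RealMat d)) ⊆ K →
          0 < lowerSpectralRadius (A : Set (RealMat d)) ∧
          0 < lowerSpectralRadius (B : Set (RealMat d)) ∧
          |Real.log (lowerSpectralRadius (A : Set (RealMat d))) -
              Real.log (lowerSpectralRadius (B : Set (RealMat d)))| ≤
            L * Metric.hausdorffDist (A : Set (RealMat d)) (B : Set (RealMat d)) := by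
  refine ⟨isOpen_oneDominated hd, locallyLipschitzOn_lowerSpectralRadius hd, fun K hK => ?_⟩
  obtain ⟨-, C, hC⟩ := (mem_oneDominated_iff hd).1 hK
  obtain ⟨L, hL, hbound⟩ := hC.exists_lowerSpectralRadius_bounds K.isCompact
  have hlog : ∀ A B : NonemptyCompacts (RealMat d), (A : Set (RealMat d)) ⊆ K →
      (B : Set (RealMat d)) ⊆ K → Real.log (lowerSpectralRadius (B : Set (RealMat d))) -
        Real.log (lowerSpectralRadius (A : Set (RealMat d))) ≤ L * dist A B := by
    intro A B hA hB
    obtain ⟨hApos, hle⟩ := hbound A B hA hB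
    have hBpos := (hbound B A hB hA).1
    have h0 : 0 < 1 + L * dist A B := by positivity
    have h1 := Real.log_le_log hBpos hle
    rw [Real.log_mul h0.ne' hApos.ne'] at h1
    -- `log (1 + x) ≤ x` keeps the same constant `L`.
    have h2 := Real.log_le_sub_one_of_pos h0
    linarith
  refine ⟨L, hL, fun A B hA hB => ⟨(hbound A B hA hB).1, (hbound B A hB hA).1, ?_⟩⟩
  rw [← Metric.NonemptyCompacts.dist_eq, abs_sub_le_iff]
  exact ⟨by rw [dist_comm]; exact hlog B A hB hA, hlog A B hA hB⟩
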